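/- Fix integers $b\ge 1$ and $1\le j\le n$. An (unordered) bucket increasing tree of size $n$ is a rooted tree whose nodes (buckets) contain the labels $1,\dots,n$, each exactly once, such that every node $v$ contains between $1$ and $b$ labels (its capacity $c(v)$), every node with at least one child is saturated, i.e. has capacity $b$, and every label in a node is smaller than every label in each of its children. Let $d^+(v)$ denote the out-degree (number of children) of $v$. A tree evolution process $T_1,T_2,\dots$ starts with a single bucket containing only the label $1$; given $T_n$, a node $v\in T_n$ attracts the label $n+1$ with probability $p(v)$; if $c(v)<b$ the label $n+1$ is added to $v$, and otherwise it is attached to $v$ as a new child bucket containing only $n+1$. *Bucket recursive trees* are generated by $p(v)=\frac{c(v)}{n}$, and *$(b,\alpha)$-plane oriented recursive trees* ($(b,\alpha)$-PORTs), with real $\alpha>0$, by $p(v)=\frac{d^+(v)+(\alpha+1)c(v)-1}{(\alpha+1)n-1}$. Let $X_{n,j}$ be the out-degree of the bucket containing label $j$ in $T_n$; let $Y_{n,j}$ be the number of descendants of $j$ in $T_n$, i.e. the number of labels $\ge j$ contained in the subtree of $T_n$ rooted at the bucket containing $j$; and let $K_j$ be the size of the bucket containing $j$ in $T_j$. Let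 $\tau_{n,j}:=\min\{\ell: j\le \ell\le n,\ Y_{\ell,j}=b+1-K_j\}$ be the time at which the bucket containing $j$ becomes saturated, with $\tau_{n,j}:=n$ if there is no such $\ell$. **Theorem.** * For bucket recursive trees, $$X_{n,j}\stackrel{(d)}{=}\sum_{\ell=\tau_{n,j}+1}^{n} I_\ell ,$$ where the indicators $I_\ell$, $b+1\le \ell\le n$, are mutually independent and independent of $\tau_{n,j}$, with $\mathbb P\{I_\ell=1\}=1-\mathbb P\{I_\ell=0\}=\frac{b}{\ell-1}$. * For $(b,\alpha)$-PORTs, $$X_{n,j}\stackrel{(d)}{=} W_{n-\tau_{n,j}}(w_0,b_0)-w_0,\qquad w_0=b(\alpha+1)-1,\quad b_0=(\alpha+1)(\tau_{n,j}-b),$$ where, conditionally on $\tau_{n,j}$, $W_N(w_0,b_0)$ is the number of white balls after $N$ draws in the balanced triangular urn model with initially $w_0$ white and $b_0$ black balls and replacement matrix $\left(\begin{smallmatrix}1&\alpha\\0&1+\alpha\end{smallmatrix}\right)$: each draw is white with probability equal to the current proportion of white balls, a white draw adds $1$ white and $\alpha$ black balls, and a black draw adds $1+\alpha$ black balls. (If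 $\tau_{n,j}=n$, no draw is made and the right-hand side is $0$.) In both cases the identity holds jointly with $\tau_{n,j}$: for bucket recursive trees $(\tau_{n,j},X_{n,j})\stackrel{(d)}{=}(\tau_{n,j},\sum_{\ell=\tau_{n,j}+1}^{n}I_\ell)$, and for $(b,\alpha)$-PORTs $(\tau_{n,j},X_{n,j})\stackrel{(d)}{=}(\tau_{n,j},W_{n-\tau_{n,j}}(w_0,b_0)-w_0)$. -/

import Mathlib

open MeasureTheory ProbabilityTheory Finset
open scoped ENNReal

noncomputable section

/-- An unordered bucket increasing tree with maximal bucket size `b`, whose labels are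
`1, …, size`.  A node (bucket) is named by its smallest label: `node i` is the node that contains
the label `i`, so that `v` is a node if and only if `1 ≤ v ≤ size` and `node v = v`.  The root is
the node `1`, and `parent v` is the parent of a node `v ≠ 1`.  Both functions are `0` where they
have no meaning, so every tree is represented exactly once. -/
@[ext]
structure BucketTree (b : ℕ) where
  size : ℕ
  node : ℕ → ℕ
  parent : ℕ → ℕ
  size_pos : 1 ≤ size
  node_out : ∀ i, i ∉ Icc 1 size → node i = 0
  node_mem : ∀ i ∈ Icc 1 size, node i ∈ Icc 1 i
  node_node : ∀ i ∈ Icc 1 size, node (node i) = node i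
  /-- every bucket holds at most `b` labels -/
  card_le : ∀ v, #{i ∈ Icc 1 size | node i = v} ≤ b
  parent_out : ∀ v, ¬ (v ∈ Icc 2 size ∧ node v = v) → parent v = 0
  parent_node : ∀ v ∈ Icc 2 size, node v = v →
    parent v ∈ Icc 1 size ∧ node (parent v) = parent v
  /-- every node that has a child is saturated -/
  parent_full : ∀ v ∈ Icc 2 size, node v = v → #{i ∈ Icc 1 size | node i = parent v} = b
  /-- labels increase along every path that starts at the root -/
  parent_lt : ∀ v ∈ Icc 2 size, node v = v → ∀ i ∈ Icc 1 size, node i = parent v → i < v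

namespace BucketTree

variable {b : ℕ}

/-- The discrete σ-algebra on the (countable) set of bucket increasing trees. -/
instance : MeasurableSpace (BucketTree b) := ⊤

/-- The set of nodes of a tree. -/
def nodes (t : BucketTree b) : Finset ℕ := {v ∈ Icc 1 t.size | t.node v = v}

/-- The capacity `c(v)`: the number of labels in the node `v`. -/
def capacity (t : BucketTree b) (v : ℕ) : ℕ := #{i ∈ Icc 1 t.size | t.node i = v}

/-- The out-degree of the node `v`: its number of children. -/
def outDegree (t : BucketTree b) (v : ℕ) : ℕ := #{u ∈ t.nodes | t.parent u = v}

/-- The node `u` lies in the subtree rooted at the node `v`. -/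
def InSubtree (t : BucketTree b) (v u : ℕ) : Prop := ∃ k : ℕ, t.parent^[k] u = v

open Classical in
/-- The number of descendants of the label `j`: the number of labels `i ≥ j` contained in the
subtree rooted at the node that contains `j`. -/
def descendants (t : BucketTree b) (j : ℕ) : ℕ :=
  #{i ∈ Icc j t.size | t.InSubtree (t.node j) (t.node i)}

theorem mem_nodes {t : BucketTree b} {v : ℕ} :
    v ∈ t.nodes ↔ v ∈ Icc 1 t.size ∧ t.node v = v := by
  simp [nodes]

/-- Counting the labels of a node after the label `size + 1` has been put into the node `w`. -/
theorem card_update (t : BucketTree b) (w v : ℕ) :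
    #{i ∈ Icc 1 (t.size + 1) | Function.update t.node (t.size + 1) w i = v} =
      t.capacity v + if w = v then 1 else 0 := by
  have h1 : Icc 1 (t.size + 1) = insert (t.size + 1) (Icc 1 t.size) := by
    ext x; simp only [mem_insert, mem_Icc]; omega
  have h2 : {i ∈ Icc 1 t.size | Function.update t.node (t.size + 1) w i = v} =
      {i ∈ Icc 1 t.size | t.node i = v} := by
    apply filter_congr
    intro i hi
    rw [mem_Icc] at hi
    rw [Function.update_of_ne (by omega)]
  rw [h1, filter_insert, Function.update_self, h2]
  split_ifs with h
  · rw [card_insert_of_notMem (by simp)]; rfl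
  · rfl

/-- Put the new label `size + 1` into the unsaturated node `v`. -/
def addLabel (t : BucketTree b) (v : ℕ) (hv : v ∈ t.nodes) (hc : t.capacity v < b) :
    BucketTree b where
  size := t.size + 1
  node := Function.update t.node (t.size + 1) v
  parent := t.parent
  size_pos := by omega
  node_out i hi := by
    rw [mem_Icc] at hi
    rw [Function.update_of_ne (by omega)]
    exact t.node_out i (by rw [mem_Icc]; omega)
  node_mem i hi := by
    have hv' := mem_nodes.1 hv
    rw [mem_Icc] at *
    by_cases h : i = t.size + 1
    · subst h; rw [Function.update_self]; omega
    · rw [Function.update_of_ne h]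
      have := t.node_mem i (by rw [mem_Icc]; omega)
      rwa [mem_Icc] at this
  node_node i hi := by
    have hv' := mem_nodes.1 hv
    rw [mem_Icc] at *
    by_cases h : i = t.size + 1
    · subst h; rw [Function.update_self, Function.update_of_ne (by omega)]; exact hv'.2
    · rw [Function.update_of_ne h]
      have := t.node_mem i (by rw [mem_Icc]; omega)
      rw [mem_Icc] at this
      rw [Function.update_of_ne (by omega)]
      exact t.node_node i (by rw [mem_Icc]; omega)
  card_le w := by
    rw [card_update]
    have := t.card_le w
    unfold capacity at *
    split_ifs with h
    · subst h; omega
    · omega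
  parent_out w hw := by
    apply t.parent_out
    rintro ⟨h1, h2⟩
    rw [mem_Icc] at *
    exact hw ⟨by omega, by rw [Function.update_of_ne (by omega)]; exact h2⟩
  parent_node w hw h := by
    have hv' := mem_nodes.1 hv
    rw [mem_Icc] at *
    by_cases hw' : w = t.size + 1
    · subst hw'; rw [Function.update_self] at h; omega
    · rw [Function.update_of_ne hw'] at h
      have := t.parent_node w (by rw [mem_Icc]; omega) h
      rw [mem_Icc] at this
      exact ⟨by omega, by rw [Function.update_of_ne (by omega)]; exact this.2⟩
  parent_full w hw h := by
    have hv' := mem_nodes.1 hv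
    rw [mem_Icc] at *
    by_cases hw' : w = t.size + 1
    · subst hw'; rw [Function.update_self] at h; omega
    · rw [Function.update_of_ne hw'] at h
      have := t.parent_full w (by rw [mem_Icc]; omega) h
      rw [card_update]
      unfold capacity at *
      split_ifs with h3
      · subst h3; omega
      · omega
  parent_lt w hw h i hi hp := by
    have hv' := mem_nodes.1 hv
    rw [mem_Icc] at *
    by_cases hw' : w = t.size + 1
    · subst hw'; rw [Function.update_self] at h; omega
    · rw [Function.update_of_ne hw'] at h
      have hw2 : w ∈ Icc 2 t.size := by rw [mem_Icc]; omega
      by_cases hi' : i = t.size + 1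
      · subst hi'
        rw [Function.update_self] at hp
        have := t.parent_full w hw2 h
        unfold capacity at hc
        rw [hp] at hc
        omega
      · rw [Function.update_of_ne hi'] at hp
        exact t.parent_lt w hw2 h i (by rw [mem_Icc]; omega) hp

/-- Attach a new bucket that contains only the label `size + 1` to the saturated node `v`. -/
def addChild (t : BucketTree b) (v : ℕ) (hv : v ∈ t.nodes) (hc : t.capacity v = b) :
    BucketTree b where
  size := t.size + 1
  node := Function.update t.node (t.size + 1) (t.size + 1)
  parent := Function.update t.parent (t.size + 1) v
  size_pos := by omega
  node_out i hi := by
    rw [mem_Icc] at hi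
    rw [Function.update_of_ne (by omega)]
    exact t.node_out i (by rw [mem_Icc]; omega)
  node_mem i hi := by
    rw [mem_Icc] at *
    by_cases h : i = t.size + 1
    · subst h; rw [Function.update_self]; omega
    · rw [Function.update_of_ne h]
      have := t.node_mem i (by rw [mem_Icc]; omega)
      rwa [mem_Icc] at this
  node_node i hi := by
    rw [mem_Icc] at *
    by_cases h : i = t.size + 1
    · subst h; rw [Function.update_self, Function.update_self]
    · rw [Function.update_of_ne h]
      have := t.node_mem i (by rw [mem_Icc]; omega)
      rw [mem_Icc] at this
      rw [Function.update_of_ne (by omega)]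
      exact t.node_node i (by rw [mem_Icc]; omega)
  card_le w := by
    rw [card_update]
    split_ifs with h
    · subst h
      have h0 : t.capacity (t.size + 1) = 0 := by
        unfold capacity
        rw [card_eq_zero, filter_eq_empty_iff]
        intro i hi h
        have := t.node_mem i hi
        rw [mem_Icc] at *
        omega
      have hpos : 0 < t.capacity v := by
        unfold capacity
        exact card_pos.2 ⟨v, mem_filter.2 (mem_nodes.1 hv)⟩
      omega
    · exact t.card_le w
  parent_out w hw := by
    rw [mem_Icc] at hw
    by_cases h : w = t.size + 1
    · subst h
      rw [Function.update_self] at hw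
      have := t.size_pos
      exact absurd ⟨⟨by omega, le_refl _⟩, rfl⟩ hw
    · rw [Function.update_of_ne h] at hw
      rw [Function.update_of_ne h]
      apply t.parent_out
      rw [mem_Icc]
      rintro ⟨h1, h2⟩
      exact hw ⟨by omega, h2⟩
  parent_node w hw h := by
    have hv' := mem_nodes.1 hv
    rw [mem_Icc] at *
    by_cases hw' : w = t.size + 1
    · subst hw'
      rw [Function.update_self]
      exact ⟨by omega, by rw [Function.update_of_ne (by omega)]; exact hv'.2⟩
    · rw [Function.update_of_ne hw'] at h
      rw [Function.update_of_ne hw']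
      have := t.parent_node w (by rw [mem_Icc]; omega) h
      rw [mem_Icc] at this
      exact ⟨by omega, by rw [Function.update_of_ne (by omega)]; exact this.2⟩
  parent_full w hw h := by
    have hv' := mem_nodes.1 hv
    rw [mem_Icc] at *
    by_cases hw' : w = t.size + 1
    · subst hw'
      rw [Function.update_self, card_update, if_neg (by omega)]
      exact hc
    · rw [Function.update_of_ne hw'] at h
      have hw2 : w ∈ Icc 2 t.size := by rw [mem_Icc]; omega
      have h1 := t.parent_node w hw2 h
      rw [mem_Icc] at h1
      rw [Function.update_of_ne hw', card_update, if_neg (by omega)]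
      exact t.parent_full w hw2 h
  parent_lt w hw h i hi hp := by
    have hv' := mem_nodes.1 hv
    rw [mem_Icc] at *
    by_cases hw' : w = t.size + 1
    · subst hw'
      rw [Function.update_self] at hp
      by_cases hi' : i = t.size + 1
      · subst hi'; rw [Function.update_self] at hp; omega
      · omega
    · rw [Function.update_of_ne hw'] at h hp
      have hw2 : w ∈ Icc 2 t.size := by rw [mem_Icc]; omega
      have h1 := t.parent_node w hw2 h
      rw [mem_Icc] at h1
      by_cases hi' : i = t.size + 1
      · subst hi'; rw [Function.update_self] at hp; omega
      · rw [Function.update_of_ne hi'] at hp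
        exact t.parent_lt w hw2 h i (by rw [mem_Icc]; omega) hp

/-- The tree that results when the node `v` of `t` attracts the new label `size + 1`. -/
def attract (t : BucketTree b) (v : ℕ) (hv : v ∈ t.nodes) : BucketTree b :=
  if hc : t.capacity v < b then t.addLabel v hv hc
  else t.addChild v hv (le_antisymm (t.card_le v) (not_lt.1 hc))

/-- Growth rule of bucket recursive trees: the probability that `v` attracts the next label. -/
def recursiveRule (t : BucketTree b) (v : ℕ) : ℝ := (t.capacity v : ℝ) / t.size

/-- Growth rule of `(b, α)`-plane oriented recursive trees: the probability that `v` attracts the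
next label. -/
def portRule (α : ℝ) (t : BucketTree b) (v : ℕ) : ℝ :=
  ((t.outDegree v : ℝ) + (α + 1) * t.capacity v - 1) / ((α + 1) * t.size - 1)

end BucketTree

open BucketTree

/-- `T 1, T 2, …` is a tree evolution process in which a node `v` of a tree `t` attracts the next
label with probability `p t v`.  It starts with the (unique) tree of size `1`, a single bucket that
contains only the label `1`.  Since `T (n + 1)` determines `T n`, conditioning on `T n` is the same
as conditioning on the whole past. -/
structure IsGrowthProcess {b : ℕ} {Ω : Type*} [MeasurableSpace Ω] (p : BucketTree b → ℕ → ℝ)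
    (T : ℕ → Ω → BucketTree b) (P : Measure Ω) : Prop where
  measurable : ∀ n, Measurable (T n)
  init : ∀ᵐ ω ∂P, (T 1 ω).size = 1
  step : ∀ n, 1 ≤ n → ∀ (t : BucketTree b) (v : ℕ) (hv : v ∈ t.nodes),
    P {ω | T n ω = t ∧ T (n + 1) ω = t.attract v hv} =
      P {ω | T n ω = t} * ENNReal.ofReal (p t v)

section Parameters

variable {b : ℕ} {Ω : Type*} (T : ℕ → Ω → BucketTree b)

/-- `X_{n,j}`: the out-degree of the bucket containing the label `j` in the tree of size `n`. -/
def labelOutDegree (n j : ℕ) (ω : Ω) : ℕ := (T n ω).outDegree ((T n ω).node j)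

/-- `Y_{n,j}`: the number of descendants of the label `j` in the tree of size `n`. -/
def numDescendants (n j : ℕ) (ω : Ω) : ℕ := (T n ω).descendants j

/-- `K_j`: the size of the bucket containing the label `j` in the tree of size `j`. -/
def initialBucketSize (j : ℕ) (ω : Ω) : ℕ := (T j ω).capacity ((T j ω).node j)

open Classical in
/-- `τ_{n,j}`: the least `ℓ` with `j ≤ ℓ ≤ n` and `Y_{ℓ,j} = b + 1 - K_j`, which is the time when
the bucket containing `j` becomes saturated; it equals `n` if there is no such `ℓ`. -/
def saturationTime (n j : ℕ) (ω : Ω) : ℕ :=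
  if ∃ ℓ ∈ Icc j n, numDescendants T ℓ j ω + initialBucketSize T j ω = b + 1 then
    sInf {ℓ | ℓ ∈ Icc j n ∧ numDescendants T ℓ j ω + initialBucketSize T j ω = b + 1}
  else n

end Parameters

/-- Draw a ball from an urn with `s.1` white and `s.2` black balls; `true` means that the ball is
white.  (The minimum has no effect if `s.1, s.2 ≥ 0` and `s.1 + s.2 > 0`.) -/
def drawBall (s : ℝ × ℝ) : PMF Bool :=
  PMF.ofFintype
    (fun c => if c then min 1 (ENNReal.ofReal (s.1 / (s.1 + s.2)))
      else 1 - min 1 (ENNReal.ofReal (s.1 / (s.1 + s.2))))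
    (by simp [add_tsub_cancel_of_le])

/-- The distribution of the (white, black) composition after `N` draws of the balanced triangular
urn with replacement matrix `(1, α; 0, 1 + α)` and initial composition `(w₀, b₀)`: a white draw
adds one white ball and `α` black balls, a black draw adds `1 + α` black balls. -/
def triangularUrn (α w₀ b₀ : ℝ) : ℕ → PMF (ℝ × ℝ)
  | 0 => PMF.pure (w₀, b₀)
  | N + 1 => (triangularUrn α w₀ b₀ N).bind fun s =>
      (drawBall s).map fun c => if c then (s.1 + 1, s.2 + α) else (s.1, s.2 + (1 + α))

/-- The law of `W_N(w₀, b₀)`, the number of white balls of the triangular urn after `N` draws. -/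
def whiteBallLaw (α w₀ b₀ : ℝ) (N : ℕ) : Measure ℝ :=
  ((triangularUrn α w₀ b₀ N).map Prod.fst).toMeasure

end

/-! A label never leaves its bucket, and a bucket gets its first child only after it is full. Up to
its filling time the bucket of `j` therefore has capacity `Y + K - 1` (`descendants_add`), so `τ` is
indeed the filling time, or `n` by default, and the out-degree at time `τ` is zero
(`labelOutDegree_saturationTime`). Moreover, for `t < n` the event `τ = t` can be read off from the
single tree `T m`, for any `m ≥ t` (`saturationTime_eq_iff`).

After saturation the capacity is frozen at `b`, so the chance of gaining a child depends only on the
time `m` and the out-degree `d`: it is `b / m` for the recursive rule and `(d + (α + 1) b - 1) / ((α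
+ 1) m - 1)` for PORTs. Given `τ = t`, the out-degree is thus a pure birth chain started in `0` at
time `t` (`measure_saturationTime_labelOutDegree`).

Both right-hand sides are realizations of this chain: as partial sums of independent indicators
(`hasLaw_sum_indicators`) and as the number of white draws from the urn
(`whiteBallLaw_eq_map_pureBirthLaw`). Mixing over `τ` gives the joint identity
(`identDistrib_prodMk_of_conditional_law`). The pathwise arguments apply almost surely because the
growth rules sum to one (`ae_isGrowthPath`). -/

namespace BucketTree

variable {b : ℕ}

/-! ### Effect of one growth step, and total mass of the growth rules. -/

theorem attract_size (t : BucketTree b) (v : ℕ) (hv : v ∈ t.nodes) :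
    (t.attract v hv).size = t.size + 1 := by
  unfold attract; split_ifs <;> rfl

theorem attract_node (t : BucketTree b) (v : ℕ) (hv : v ∈ t.nodes) {i : ℕ} (hi : i ≤ t.size) :
    (t.attract v hv).node i = t.node i := by
  unfold attract
  split_ifs <;> exact Function.update_of_ne (by omega) _ _

theorem node_mem_nodes (t : BucketTree b) {i : ℕ} (hi : i ∈ Icc 1 t.size) :
    t.node i ∈ t.nodes := by
  have h := t.node_mem i hi
  refine mem_nodes.2 ⟨?_, t.node_node i hi⟩
  rw [mem_Icc] at *
  omega

/-- The new label reveals who attracted it: its bucket is `v` itself, or it is a new bucket with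
parent `v`. The cases cannot be confused since `v ≤ t.size`. -/
theorem attract_injective (t : BucketTree b) {v w : ℕ} (hv : v ∈ t.nodes) (hw : w ∈ t.nodes)
    (h : t.attract v hv = t.attract w hw) : v = w := by
  have hv' := mem_Icc.1 (mem_nodes.1 hv).1
  have hw' := mem_Icc.1 (mem_nodes.1 hw).1
  have h1 := congrArg (fun s => s.node (t.size + 1)) h
  have h2 := congrArg (fun s => s.parent (t.size + 1)) h
  unfold attract at h1 h2
  split_ifs at h1 h2 <;> simp [addLabel, addChild] at h1 h2 <;> omega

theorem outDegree_addLabel (t : BucketTree b) (v : ℕ) (hv : v ∈ t.nodes) (hc : t.capacity v < b)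
    (w : ℕ) : (t.addLabel v hv hc).outDegree w = t.outDegree w := by
  have hv' := mem_Icc.1 (mem_nodes.1 hv).1
  have h : (t.addLabel v hv hc).nodes = t.nodes := by
    ext x
    simp only [mem_nodes, addLabel, mem_Icc]
    by_cases hx : x = t.size + 1
    · subst hx; rw [Function.update_self]; omega
    · rw [Function.update_of_ne hx]; omega
  unfold outDegree
  rw [h]; rfl

theorem outDegree_addChild (t : BucketTree b) (v : ℕ) (hv : v ∈ t.nodes) (hc : t.capacity v = b)
    (w : ℕ) : (t.addChild v hv hc).outDegree w = t.outDegree w + if v = w then 1 else 0 := by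
  have h : (t.addChild v hv hc).nodes = insert (t.size + 1) t.nodes := by
    ext x
    simp only [mem_insert, mem_nodes, addChild, mem_Icc]
    by_cases hx : x = t.size + 1
    · subst hx; simp
    · rw [Function.update_of_ne hx]; omega
  have hn : t.size + 1 ∉ t.nodes := by simp [mem_nodes]
  have h2 : {u ∈ t.nodes | (t.addChild v hv hc).parent u = w} =
      {u ∈ t.nodes | t.parent u = w} := by
    refine filter_congr fun u hu => ?_
    have : u ≠ t.size + 1 := fun h => hn (h ▸ hu)
    simp [addChild, Function.update_of_ne this]
  unfold outDegree
  rw [h, filter_insert, h2]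
  have h3 : (t.addChild v hv hc).parent (t.size + 1) = v := by simp [addChild]
  rw [h3]
  split_ifs with h4
  · rw [card_insert_of_notMem (by simp [hn])]
  · rfl

/-- The out-degree of a saturated node changes only if the node itself attracts the label. -/
theorem outDegree_attract (t : BucketTree b) (v : ℕ) (hv : v ∈ t.nodes) {w : ℕ}
    (hw : t.capacity w = b) :
    (t.attract v hv).outDegree w = t.outDegree w + if v = w then 1 else 0 := by
  unfold attract
  split_ifs with h1 h2 h2
  · subst h2; omega
  · exact outDegree_addLabel ..
  · rw [outDegree_addChild, if_pos h2]
  · rw [outDegree_addChild, if_neg h2]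

theorem sum_capacity (t : BucketTree b) : ∑ v ∈ t.nodes, t.capacity v = t.size := by
  have := card_eq_sum_card_fiberwise (f := t.node) (s := Icc 1 t.size) (t := t.nodes)
    fun i hi => t.node_mem_nodes hi
  rw [Nat.card_Icc] at this
  unfold capacity
  omega

theorem one_mem_nodes (t : BucketTree b) : 1 ∈ t.nodes := by
  have h1 : 1 ∈ Icc 1 t.size := mem_Icc.2 ⟨le_rfl, t.size_pos⟩
  have := mem_Icc.1 (t.node_mem 1 h1)
  exact mem_nodes.2 ⟨h1, by omega⟩

/-- Every node except the root is the child of exactly one node; the root has the dummy parent `0`,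
which is not a node. -/
theorem sum_outDegree (t : BucketTree b) : ∑ v ∈ t.nodes, t.outDegree v + 1 = #t.nodes := by
  have h1 : ∀ u ∈ t.nodes, u ≠ 1 → t.parent u ∈ t.nodes := fun u hu hu1 => by
    have hu' := mem_nodes.1 hu
    have := mem_Icc.1 hu'.1
    exact mem_nodes.2 (t.parent_node u (mem_Icc.2 (by omega)) hu'.2)
  have h2 : t.parent 1 = 0 := t.parent_out 1 (by simp)
  have h3 := card_eq_sum_card_fiberwise (f := t.parent) (s := t.nodes.erase 1) (t := t.nodes)
    fun u hu => h1 u (mem_of_mem_erase hu) (ne_of_mem_erase hu)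
  have h4 : ∀ v ∈ t.nodes, #{u ∈ t.nodes.erase 1 | t.parent u = v} = t.outDegree v := by
    intro v hv
    have := mem_Icc.1 (mem_nodes.1 hv).1
    unfold outDegree
    congr 1
    ext u
    simp only [mem_filter, mem_erase]
    constructor
    · exact fun h => ⟨h.1.2, h.2⟩
    · refine fun h => ⟨⟨?_, h.1⟩, h.2⟩
      rintro rfl
      omega
  rw [← sum_congr rfl h4, ← h3, card_erase_add_one t.one_mem_nodes]

theorem sum_recursiveRule (t : BucketTree b) : ∑ v ∈ t.nodes, recursiveRule t v = 1 := by
  unfold recursiveRule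
  rw [← sum_div, ← Nat.cast_sum, sum_capacity, div_self]
  have := t.size_pos
  positivity

/-- With `k` nodes the numerators add up to `(k - 1) + (α + 1) * size - k`, which is the
denominator. -/
theorem sum_portRule {α : ℝ} (hα : 0 < α) (t : BucketTree b) :
    ∑ v ∈ t.nodes, portRule α t v = 1 := by
  have h : (1 : ℝ) ≤ t.size := by exact_mod_cast t.size_pos
  have h0 : (α + 1) * t.size - 1 ≠ 0 := by nlinarith
  unfold portRule
  rw [← sum_div, div_eq_one_iff_eq h0, sum_sub_distrib, sum_add_distrib, ← mul_sum,
    ← Nat.cast_sum, ← Nat.cast_sum, sum_capacity]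
  have := congrArg (Nat.cast (R := ℝ)) t.sum_outDegree
  push_cast at this
  simp only [sum_const, nsmul_eq_mul, mul_one]
  push_cast
  linarith

/-- Both functions vanish beyond `size`, so finite lists encode a tree. Countability lets events be
split over the values of `T n`, and makes every set of pairs of trees measurable. -/
instance : Countable (BucketTree b) := by
  let f : BucketTree b → ℕ × List ℕ × List ℕ := fun t =>
    (t.size, (List.range (t.size + 1)).map t.node, (List.range (t.size + 1)).map t.parent)
  refine Function.Injective.countable (f := f) fun s t h => ?_
  simp only [f, Prod.mk.injEq] at h
  obtain ⟨h1, h2, h3⟩ := h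
  rw [← h1, List.map_inj_left] at h2 h3
  simp only [List.mem_range] at h2 h3
  refine BucketTree.ext h1 (funext fun i => ?_) (funext fun i => ?_)
  · by_cases hi : i < s.size + 1
    · exact h2 i hi
    · rw [s.node_out i (by simp; omega), t.node_out i (by simp; omega)]
  · by_cases hi : i < s.size + 1
    · exact h3 i hi
    · rw [s.parent_out i (by simp; omega), t.parent_out i (by simp; omega)]

instance : DiscreteMeasurableSpace (BucketTree b) := ⟨fun _ => trivial⟩

/-! ### Childless buckets and the filling history of a bucket. -/

/-- An out-degree is zero if the node holds the newest label or is not saturated. -/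
theorem outDegree_eq_zero (t : BucketTree b) {v : ℕ} (hv : 1 ≤ v)
    (h : t.node t.size = v ∨ t.capacity v ≠ b) : t.outDegree v = 0 := by
  unfold outDegree
  rw [card_eq_zero, filter_eq_empty_iff]
  intro u hu hp
  obtain ⟨hu1, hu2⟩ := mem_nodes.1 hu
  have hu3 := mem_Icc.1 hu1
  have hu4 : u ∈ Icc 2 t.size := by
    rw [mem_Icc]
    refine ⟨?_, hu3.2⟩
    by_contra hlt
    obtain rfl : u = 1 := by omega
    have h0 : t.parent 1 = 0 := t.parent_out 1 (by simp)
    omega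
  rcases h with h | h
  · have := t.parent_lt u hu4 hu2 t.size (mem_Icc.2 ⟨t.size_pos, le_rfl⟩) (by rw [h, hp])
    omega
  · exact h (by rw [← hp]; exact t.parent_full u hu4 hu2)

/-- The descendants of a label in a bucket without children. -/
theorem descendants_of_outDegree_eq_zero (t : BucketTree b) {j : ℕ} (hj : j ∈ Icc 1 t.size)
    (h : t.outDegree (t.node j) = 0) :
    t.descendants j = #{i ∈ Icc j t.size | t.node i = t.node j} := by
  have hv := mem_Icc.1 (t.node_mem j hj)
  classical
  unfold descendants
  refine congrArg card (ext fun i => ?_)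
  simp only [mem_filter]
  refine and_congr_right fun _ => ⟨?_, fun h => ⟨0, h⟩⟩
  rintro ⟨k, hk⟩
  cases k with
  | zero => exact hk
  | succ k =>
    -- The penultimate point of an upward path to the bucket of `j` is a child of it: a point that
    -- is not a node would have parent `0`, which is not a bucket name.
    rw [Function.iterate_succ_apply'] at hk
    exfalso
    unfold outDegree at h
    rw [card_eq_zero, filter_eq_empty_iff] at h
    refine h (mem_nodes.2 ?_) hk
    by_contra hcon
    have := t.parent_out (t.parent^[k] (t.node i)) fun h => hcon ⟨?_, h.2⟩
    · omega
    · have := mem_Icc.1 h.1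
      exact mem_Icc.2 (by omega)

/-- The number of labels at most `ℓ` in the bucket of the label `j`. -/
def partialCapacity (t : BucketTree b) (j ℓ : ℕ) : ℕ := #{i ∈ Icc 1 ℓ | t.node i = t.node j}

theorem partialCapacity_size (t : BucketTree b) (j : ℕ) :
    t.partialCapacity j t.size = t.capacity (t.node j) := rfl

theorem partialCapacity_mono (t : BucketTree b) (j : ℕ) : Monotone (t.partialCapacity j) :=
  fun _ _ h => card_le_card (filter_subset_filter _ (Icc_subset_Icc_right h))

theorem partialCapacity_le (t : BucketTree b) (j ℓ : ℕ) : t.partialCapacity j ℓ ≤ ℓ := by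
  simpa [partialCapacity] using card_filter_le (Icc 1 ℓ) fun i => t.node i = t.node j

/-- The bucket of the label `j` is filled by the label `m`. -/
def SaturatedExactlyAt (t : BucketTree b) (j m : ℕ) : Prop :=
  t.partialCapacity j m = b ∧ ∀ ℓ ∈ Ico j m, t.partialCapacity j ℓ < b

end BucketTree

/-! ### Deterministic growth paths. -/

/-- A sequence of trees in which each tree arises from the previous one by adding a label. -/
structure IsGrowthPath {b : ℕ} (u : ℕ → BucketTree b) : Prop where
  init : (u 1).size = 1
  step : ∀ n, 1 ≤ n → ∃ v, ∃ hv : v ∈ (u n).nodes, u (n + 1) = (u n).attract v hv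

namespace IsGrowthPath

open BucketTree

variable {b : ℕ} {u : ℕ → BucketTree b}

theorem size_eq (h : IsGrowthPath u) {n : ℕ} (hn : 1 ≤ n) : (u n).size = n := by
  induction n, hn using Nat.le_induction with
  | base => exact h.init
  | succ n hn ih =>
    obtain ⟨v, hv, he⟩ := h.step n hn
    rw [he, attract_size, ih]

theorem node_eq (h : IsGrowthPath u) {ℓ m i : ℕ} (hℓ : 1 ≤ ℓ) (hm : ℓ ≤ m) (hi : i ≤ ℓ) :
    (u m).node i = (u ℓ).node i := by
  induction m, hm using Nat.le_induction with
  | base => rfl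
  | succ m hm ih =>
    obtain ⟨v, hv, he⟩ := h.step m (hℓ.trans hm)
    rw [he, attract_node _ _ _ (by rw [h.size_eq (by omega)]; omega), ih]

theorem partialCapacity_eq (h : IsGrowthPath u) {j k ℓ m : ℕ} (hj : 1 ≤ j) (hjℓ : j ≤ ℓ)
    (hk : k ≤ ℓ) (hm : ℓ ≤ m) : (u m).partialCapacity j k = (u ℓ).partialCapacity j k := by
  unfold partialCapacity
  congr 1
  refine filter_congr fun i hi => ?_
  have := mem_Icc.1 hi
  rw [h.node_eq (hj.trans hjℓ) hm (by omega), h.node_eq (hj.trans hjℓ) hm hjℓ]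

/-- Old labels stay in place, so a later tree remembers all earlier capacities. -/
theorem capacity_eq (h : IsGrowthPath u) {j ℓ m : ℕ} (hj : 1 ≤ j) (hjℓ : j ≤ ℓ) (hm : ℓ ≤ m) :
    (u ℓ).capacity ((u ℓ).node j) = (u m).partialCapacity j ℓ := by
  rw [h.partialCapacity_eq hj hjℓ le_rfl hm, ← partialCapacity_size, h.size_eq (by omega)]

/-- An unsaturated bucket has no children, and a bucket just filled contains the newest label, which
no child could exceed. -/
theorem outDegree_eq_zero (h : IsGrowthPath u) {j ℓ m : ℕ} (hj : 1 ≤ j) (hjℓ : j ≤ ℓ) (hm : ℓ ≤ m)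
    (hs : (u m).partialCapacity j ℓ < b ∨ (u m).SaturatedExactlyAt j ℓ) :
    (u ℓ).outDegree ((u ℓ).node j) = 0 := by
  have hsz := h.size_eq (n := ℓ) (by omega)
  have hv := mem_Icc.1 ((u ℓ).node_mem j (mem_Icc.2 (by omega)))
  rw [← h.capacity_eq hj hjℓ hm] at hs
  rcases hs with hs | hs
  · exact (u ℓ).outDegree_eq_zero hv.1 (Or.inr hs.ne)
  · refine (u ℓ).outDegree_eq_zero hv.1 (Or.inl ?_)
    rw [hsz]
    rcases hjℓ.eq_or_lt with rfl | hlt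
    · rfl
    -- If the label `ℓ` lay elsewhere, the bucket would already have been full at time `ℓ - 1`.
    · by_contra hne
      have h1 := hs.2 (ℓ - 1) (mem_Ico.2 (by omega))
      have h2 := hs.1
      rw [h.partialCapacity_eq hj hjℓ (by omega) hm] at h1
      rw [h.partialCapacity_eq hj hjℓ (by omega) hm] at h2
      have h3 : (u ℓ).partialCapacity j ℓ = (u ℓ).partialCapacity j (ℓ - 1) := by
        unfold partialCapacity
        congr 1
        ext i
        simp only [mem_filter, mem_Icc]
        constructor
        · rintro ⟨hi, he⟩
          have : i ≠ ℓ := by rintro rfl; exact hne he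
          exact ⟨by omega, he⟩
        · rintro ⟨hi, he⟩
          exact ⟨by omega, he⟩
      omega

/-- Without children, the descendants are the labels `≥ j` of the bucket, while `K_j` counts those
`≤ j`; the label `j` is counted twice, whence the `+ 1`. -/
theorem descendants_add (h : IsGrowthPath u) {j ℓ m : ℕ} (hj : 1 ≤ j) (hjℓ : j ≤ ℓ) (hm : ℓ ≤ m)
    (hs : (u m).partialCapacity j ℓ < b ∨ (u m).SaturatedExactlyAt j ℓ) :
    (u ℓ).descendants j + (u j).capacity ((u j).node j) = (u m).partialCapacity j ℓ + 1 := by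
  have hsz := h.size_eq (n := ℓ) (by omega)
  rw [(u ℓ).descendants_of_outDegree_eq_zero (mem_Icc.2 (by omega))
    (h.outDegree_eq_zero hj hjℓ hm hs), hsz, h.capacity_eq hj le_rfl hjℓ,
    h.partialCapacity_eq hj hjℓ le_rfl hm]
  unfold partialCapacity
  have h1 : Icc j ℓ ∪ Icc 1 j = Icc 1 ℓ := by ext; simp only [mem_union, mem_Icc]; omega
  have h2 : Icc j ℓ ∩ Icc 1 j = {j} := by
    ext; simp only [mem_inter, mem_Icc, mem_singleton]; omega
  rw [← card_union_add_card_inter, ← filter_union, ← filter_inter_distrib, h1, h2,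
    filter_singleton, if_pos rfl, card_singleton]

end IsGrowthPath

/-! ### The saturation time as a filling time. -/

section SaturationTime

open BucketTree

variable {b : ℕ} {Ω : Type*} {T : ℕ → Ω → BucketTree b} {ω : Ω} {n j : ℕ}

/-- The hypothesis `hlt` confines `ℓ` to times up to the first filling; later the descendants also
include labels outside the bucket. -/
theorem numDescendants_add_eq_iff (h : IsGrowthPath fun k => T k ω) (hj : 1 ≤ j) {ℓ : ℕ}
    (hℓ : ℓ ∈ Icc j n) (hlt : ∀ k ∈ Ico j ℓ, (T n ω).partialCapacity j k < b) :
    numDescendants T ℓ j ω + initialBucketSize T j ω = b + 1 ↔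
      (T n ω).partialCapacity j ℓ = b := by
  rw [mem_Icc] at hℓ
  have hle : (T n ω).partialCapacity j ℓ ≤ b := by
    rw [← h.capacity_eq hj hℓ.1 hℓ.2]
    exact (T ℓ ω).card_le _
  have := h.descendants_add hj hℓ.1 hℓ.2
    (hle.lt_or_eq.imp_right fun he => ⟨he, hlt⟩)
  unfold numDescendants initialBucketSize
  rw [this]
  omega

theorem saturationTime_of_saturatedExactlyAt (h : IsGrowthPath fun k => T k ω) (hj : 1 ≤ j)
    {t : ℕ} (ht : t ∈ Icc j n) (hs : (T n ω).SaturatedExactlyAt j t) :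
    saturationTime T n j ω = t := by
  have h1 := (numDescendants_add_eq_iff h hj ht hs.2).2 hs.1
  unfold saturationTime
  rw [if_pos ⟨t, ht, h1⟩]
  refine IsLeast.csInf_eq ⟨⟨ht, h1⟩, fun ℓ hℓ => ?_⟩
  by_contra hlt
  rw [mem_Icc] at ht
  have h2 := mem_Icc.1 hℓ.1
  have := (numDescendants_add_eq_iff h hj hℓ.1 fun k hk => hs.2 k ?_).1 hℓ.2
  · exact (hs.2 ℓ (mem_Ico.2 (by omega))).ne this
  · rw [mem_Ico] at *
    omega

/-- Either the bucket of `j` is filled by the label `saturationTime`, or it is not saturated in the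
tree of size `n`. -/
theorem saturationTime_spec (h : IsGrowthPath fun k => T k ω) (hj : 1 ≤ j) (hjn : j ≤ n) :
    saturationTime T n j ω ∈ Icc j n ∧
      ((T n ω).SaturatedExactlyAt j (saturationTime T n j ω) ∨
        saturationTime T n j ω = n ∧ (T n ω).partialCapacity j n < b) := by
  classical
  by_cases hex : ∃ ℓ, ℓ ∈ Icc j n ∧ (T n ω).partialCapacity j ℓ = b
  · have hf := Nat.find_spec hex
    have hmin : ∀ k ∈ Ico j (Nat.find hex), (T n ω).partialCapacity j k < b := by
      intro k hk
      rw [mem_Ico] at hk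
      have h1 := mem_Icc.1 hf.1
      have h2 := Nat.find_min hex hk.2
      have hle : (T n ω).partialCapacity j k ≤ b := by
        rw [← h.capacity_eq hj hk.1 (by omega)]
        exact (T k ω).card_le _
      exact hle.lt_of_ne fun he => h2 ⟨mem_Icc.2 (by omega), he⟩
    rw [saturationTime_of_saturatedExactlyAt h hj hf.1 ⟨hf.2, hmin⟩]
    exact ⟨hf.1, Or.inl ⟨hf.2, hmin⟩⟩
  · have hlt : ∀ k ∈ Icc j n, (T n ω).partialCapacity j k < b := by
      intro k hk
      have hk' := mem_Icc.1 hk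
      have hle : (T n ω).partialCapacity j k ≤ b := by
        rw [← h.capacity_eq hj hk'.1 hk'.2]
        exact (T k ω).card_le _
      exact hle.lt_of_ne fun he => hex ⟨k, hk, he⟩
    have hn : saturationTime T n j ω = n := by
      unfold saturationTime
      rw [if_neg]
      rintro ⟨ℓ, hℓ, he⟩
      refine hex ⟨ℓ, hℓ, (numDescendants_add_eq_iff h hj hℓ fun k hk => hlt k ?_).1 he⟩
      rw [mem_Ico] at hk
      rw [mem_Icc] at *
      omega
    rw [hn]
    exact ⟨mem_Icc.2 ⟨hjn, le_rfl⟩, Or.inr ⟨rfl, hlt n (mem_Icc.2 ⟨hjn, le_rfl⟩)⟩⟩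

/-- Filling a bucket takes `b` labels. This keeps the sum of indicators within the indices above
`b`. -/
theorem min_le_saturationTime (h : IsGrowthPath fun k => T k ω) (hj : 1 ≤ j) (hjn : j ≤ n) :
    min b n ≤ saturationTime T n j ω := by
  rcases (saturationTime_spec h hj hjn).2 with hs | hs
  · have := (T n ω).partialCapacity_le j (saturationTime T n j ω)
    rw [hs.1] at this
    omega
  · omega

theorem labelOutDegree_saturationTime (h : IsGrowthPath fun k => T k ω) (hj : 1 ≤ j)
    (hjn : j ≤ n) : labelOutDegree T (saturationTime T n j ω) j ω = 0 := by
  obtain ⟨h1, h2⟩ := saturationTime_spec h hj hjn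
  rw [mem_Icc] at h1
  refine h.outDegree_eq_zero hj h1.1 h1.2 ?_
  rcases h2 with h2 | h2
  · exact Or.inr h2
  · rw [h2.1]; exact Or.inl h2.2

/-- Makes `τ = t` an event about the current tree, as the Markov property requires. The bound `t <
n` excludes the default value `n`. -/
theorem saturationTime_eq_iff (h : IsGrowthPath fun k => T k ω) (hj : 1 ≤ j) {t m : ℕ}
    (hjt : j ≤ t) (htn : t < n) (htm : t ≤ m) :
    saturationTime T n j ω = t ↔ (T m ω).SaturatedExactlyAt j t := by
  have hpc : ∀ k ≤ t, (T m ω).partialCapacity j k = (T n ω).partialCapacity j k := fun k hk => by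
    rw [h.partialCapacity_eq hj hjt hk htm, h.partialCapacity_eq hj hjt hk htn.le]
  have hiff : (T m ω).SaturatedExactlyAt j t ↔ (T n ω).SaturatedExactlyAt j t := by
    unfold SaturatedExactlyAt
    rw [hpc t le_rfl]
    refine and_congr_right fun _ => forall₂_congr fun k hk => ?_
    rw [hpc k (mem_Ico.1 hk).2.le]
  rw [hiff]
  constructor
  · rintro rfl
    rcases (saturationTime_spec h hj (hjt.trans htn.le)).2 with h2 | h2
    · exact h2
    · omega
  · exact saturationTime_of_saturatedExactlyAt h hj (mem_Icc.2 ⟨hjt, htn.le⟩)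

end SaturationTime

/-! ### Measurability of the out-degree and the saturation time. -/

section Measurability

open BucketTree

variable {b : ℕ} {Ω : Type*} [MeasurableSpace Ω] {T : ℕ → Ω → BucketTree b}

theorem measurable_labelOutDegree (hT : ∀ n, Measurable (T n)) (n j : ℕ) :
    Measurable (labelOutDegree T n j) :=
  (Measurable.of_discrete (f := fun t : BucketTree b => t.outDegree (t.node j))).comp (hT n)

theorem measurable_saturationTime (hT : ∀ n, Measurable (T n)) (n j : ℕ) :
    Measurable (saturationTime T n j) := by
  classical
  have hD : ∀ ℓ, Measurable (numDescendants T ℓ j) := fun ℓ =>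
    (Measurable.of_discrete (f := fun t : BucketTree b => t.descendants j)).comp (hT ℓ)
  have hK : Measurable (initialBucketSize T j) :=
    (Measurable.of_discrete (f := fun t : BucketTree b => t.capacity (t.node j))).comp (hT j)
  -- Only times `ℓ ≤ n` matter, so `τ` is a function on a countable space; the reduction modulo `n +
  -- 1` in `Fin.ofNat` does not affect them.
  let F : (Fin (n + 1) → ℕ) × ℕ → ℕ := fun x =>
    if ∃ ℓ ∈ Icc j n, x.1 (Fin.ofNat (n + 1) ℓ) + x.2 = b + 1 then
      sInf {ℓ | ℓ ∈ Icc j n ∧ x.1 (Fin.ofNat (n + 1) ℓ) + x.2 = b + 1}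
    else n
  have hF : saturationTime T n j =
      F ∘ fun ω => (fun ℓ : Fin (n + 1) => numDescendants T ℓ j ω, initialBucketSize T j ω) := by
    funext ω
    have hP : ∀ ℓ, (ℓ ∈ Icc j n ∧
        numDescendants T ℓ j ω + initialBucketSize T j ω = b + 1) ↔
        (ℓ ∈ Icc j n ∧ numDescendants T (Fin.ofNat (n + 1) ℓ : Fin (n + 1)) j ω +
          initialBucketSize T j ω = b + 1) := fun ℓ => and_congr_right fun hℓ => by
      have : ((Fin.ofNat (n + 1) ℓ : Fin (n + 1)) : ℕ) = ℓ :=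
        Nat.mod_eq_of_lt (by rw [mem_Icc] at hℓ; omega)
      rw [this]
    simp only [saturationTime, F, Function.comp, hP]
  rw [hF]
  refine Measurable.of_discrete.comp (Measurable.prodMk (measurable_pi_lambda _ fun ℓ => hD ℓ) hK)

end Measurability

/-! ### Pure birth chains. -/

theorem drawBall_true (s : ℝ × ℝ) :
    drawBall s true = min 1 (ENNReal.ofReal (s.1 / (s.1 + s.2))) := by
  simp [drawBall]

theorem drawBall_false (s : ℝ × ℝ) :
    drawBall s false = 1 - ENNReal.ofReal (s.1 / (s.1 + s.2)) := by
  have : drawBall s false = 1 - min 1 (ENNReal.ofReal (s.1 / (s.1 + s.2))) := by simp [drawBall]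
  rw [this]
  rcases le_total 1 (ENNReal.ofReal (s.1 / (s.1 + s.2))) with h | h
  · rw [min_eq_left h, tsub_self, tsub_eq_zero_of_le h]
  · rw [min_eq_right h]

/-- The law, after `N` steps started in `0` at time `t`, of the chain that moves from `d` to `d + 1`
at time `m` with probability `q m d` and stays in `d` otherwise. -/
noncomputable def pureBirthLaw (q : ℕ → ℕ → ℝ) (t : ℕ) : ℕ → PMF ℕ
  | 0 => PMF.pure 0
  | N + 1 => (pureBirthLaw q t N).bind fun d =>
      (drawBall (q (t + N) d, 1 - q (t + N) d)).map fun c => if c then d + 1 else d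

theorem pureBirthLaw_succ_apply_zero (q : ℕ → ℕ → ℝ) (t N : ℕ) :
    pureBirthLaw q t (N + 1) 0 =
      pureBirthLaw q t N 0 * (1 - ENNReal.ofReal (q (t + N) 0)) := by
  rw [pureBirthLaw, PMF.bind_apply, tsum_eq_single 0]
  · simp [PMF.map_apply, drawBall_false]
  · intro d hd
    simp [PMF.map_apply, hd.symm]

theorem pureBirthLaw_succ_apply_succ (q : ℕ → ℕ → ℝ) (t N d : ℕ) :
    pureBirthLaw q t (N + 1) (d + 1) =
      pureBirthLaw q t N (d + 1) * (1 - ENNReal.ofReal (q (t + N) (d + 1))) +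
        pureBirthLaw q t N d * min 1 (ENNReal.ofReal (q (t + N) d)) := by
  rw [pureBirthLaw, PMF.bind_apply, tsum_eq_sum (s := {d + 1, d})]
  · rw [sum_pair (by omega)]
    simp [PMF.map_apply, drawBall_false, drawBall_true]
  · intro k hk
    simp only [mem_insert, mem_singleton, not_or] at hk
    have h1 : d + 1 ≠ k := fun h => hk.1 h.symm
    have h2 : d ≠ k := fun h => hk.2 h.symm
    simp [PMF.map_apply, h1, h2]

/-! ### The Markov property and the conditional law of the out-degree. -/

namespace IsGrowthProcess

open BucketTree

variable {b : ℕ} {Ω : Type*} [MeasurableSpace Ω] {p : BucketTree b → ℕ → ℝ}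
  {T : ℕ → Ω → BucketTree b} {P : Measure Ω}

/-- Given `T n = t`, the outcomes `t.attract v` are disjoint and their probabilities exhaust the
mass of `T n = t`; countably many `t` are then combined. -/
theorem ae_exists_attract [IsProbabilityMeasure P] (h : IsGrowthProcess p T P)
    (hp : ∀ t : BucketTree b, ∑ v ∈ t.nodes, p t v = 1) {n : ℕ} (hn : 1 ≤ n) :
    ∀ᵐ ω ∂P, ∃ v, ∃ hv : v ∈ (T n ω).nodes, T (n + 1) ω = (T n ω).attract v hv := by
  have key : ∀ t : BucketTree b, ∀ᵐ ω ∂P, T n ω = t →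
      ∃ v, ∃ hv : v ∈ t.nodes, T (n + 1) ω = t.attract v hv := by
    intro t
    have hmeas : ∀ s s', MeasurableSet {ω | T n ω = s ∧ T (n + 1) ω = s'} := fun s s' =>
      (h.measurable n (measurableSet_singleton s)).inter
        (h.measurable (n + 1) (measurableSet_singleton s'))
    let G := ⋃ v ∈ t.nodes.attach, {ω | T n ω = t ∧ T (n + 1) ω = t.attract v.1 v.2}
    have hGm : MeasurableSet G := .biUnion (Finset.countable_toSet _) fun v _ => hmeas _ _
    have hG : P {ω | T n ω = t} ≤ P G := by
      rw [measure_biUnion_finset]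
      · rw [sum_congr rfl fun v _ => h.step n hn t v.1 v.2, ← mul_sum]
        -- Subadditivity of `ENNReal.ofReal` suffices, so no sign condition on `p` is needed.
        have : (1 : ℝ≥0∞) ≤ ∑ v ∈ t.nodes.attach, ENNReal.ofReal (p t v.1) := by
          rw [sum_attach t.nodes fun v => ENNReal.ofReal (p t v), ← ENNReal.ofReal_one, ← hp t]
          exact le_sum_of_subadditive _ ENNReal.ofReal_zero.le (fun _ _ => ENNReal.ofReal_add_le) _ _
        calc P {ω | T n ω = t} = P {ω | T n ω = t} * 1 := (mul_one _).symm
          _ ≤ _ := by gcongr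
      · intro v _ w _ hvw
        refine Set.disjoint_left.2 fun ω hω hω' => hvw ?_
        exact Subtype.ext (t.attract_injective v.2 w.2 (hω.2.symm.trans hω'.2))
      · exact fun v _ => hmeas _ _
    have hsub : G ⊆ {ω | T n ω = t} := by
      simp only [G, Set.iUnion_subset_iff]
      exact fun v _ ω hω => hω.1
    have hae := ae_eq_of_subset_of_measure_ge hsub hG hGm.nullMeasurableSet (measure_ne_top _ _)
    filter_upwards [hae.mem_iff] with ω hω ht
    have := hω.2 ht
    simp only [G, Set.mem_iUnion] at this
    obtain ⟨v, -, hv⟩ := this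
    exact ⟨v.1, v.2, hv.2⟩
  filter_upwards [ae_all_iff.2 key] with ω hω
  exact hω _ rfl

theorem ae_isGrowthPath [IsProbabilityMeasure P] (h : IsGrowthProcess p T P)
    (hp : ∀ t : BucketTree b, ∑ v ∈ t.nodes, p t v = 1) :
    ∀ᵐ ω ∂P, IsGrowthPath fun k => T k ω := by
  have : ∀ᵐ ω ∂P, ∀ n, 1 ≤ n →
      ∃ v, ∃ hv : v ∈ (T n ω).nodes, T (n + 1) ω = (T n ω).attract v hv := by
    rw [ae_all_iff]
    intro n
    by_cases hn : 1 ≤ n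
    · filter_upwards [h.ae_exists_attract hp hn] with ω hω _ using hω
    · exact .of_forall fun ω hn' => absurd hn' hn
  filter_upwards [h.init, this] with ω h1 h2
  exact ⟨h1, h2⟩

theorem measurableSet_attract (h : IsGrowthProcess p T P) (m : ℕ) (w : BucketTree b → ℕ) :
    MeasurableSet {ω | ∃ hv : w (T m ω) ∈ (T m ω).nodes,
      T (m + 1) ω = (T m ω).attract (w (T m ω)) hv} :=
  ((h.measurable m).prodMk (h.measurable (m + 1))) (MeasurableSet.of_discrete
    (s := {x : BucketTree b × BucketTree b |
      ∃ hv : w x.1 ∈ x.1.nodes, x.2 = x.1.attract (w x.1) hv}))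

/-- The Markov property: if the node `w t` attracts the next label with the same probability `q` for
all trees `t` in `A`, then it does so independently of the event `T m ∈ A`. -/
theorem measure_mem_and_attract (h : IsGrowthProcess p T P) {m : ℕ} (hm : 1 ≤ m)
    (A : Set (BucketTree b)) (w : BucketTree b → ℕ) (hw : ∀ t ∈ A, w t ∈ t.nodes) (q : ℝ)
    (hq : ∀ t ∈ A, p t (w t) = q) :
    P ({ω | T m ω ∈ A} ∩ {ω | ∃ hv : w (T m ω) ∈ (T m ω).nodes,
      T (m + 1) ω = (T m ω).attract (w (T m ω)) hv}) =
      P {ω | T m ω ∈ A} * ENNReal.ofReal q := by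
  have h1 : {ω | T m ω ∈ A} ∩ {ω | ∃ hv : w (T m ω) ∈ (T m ω).nodes,
      T (m + 1) ω = (T m ω).attract (w (T m ω)) hv} =
      ⋃ t : A, {ω | T m ω = t ∧ T (m + 1) ω = t.1.attract (w t) (hw t t.2)} := by
    ext ω
    simp only [Set.mem_inter_iff, Set.mem_ofPred_eq, Set.mem_iUnion]
    constructor
    · rintro ⟨hA, hv, he⟩
      exact ⟨⟨_, hA⟩, rfl, he⟩
    · rintro ⟨t, ht, he⟩
      rw [ht]
      exact ⟨t.2, hw t t.2, he⟩
  have h2 : {ω | T m ω ∈ A} = ⋃ t : A, {ω | T m ω = t} := by ext ω; simp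
  rw [h1, h2, measure_iUnion, measure_iUnion, ← ENNReal.tsum_mul_right]
  · refine tsum_congr fun t => ?_
    rw [h.step m hm t.1 (w t) (hw t t.2), hq t t.2]
  · intro s t hst
    exact Set.disjoint_left.2 fun ω hω hω' => hst (Subtype.ext (Eq.trans (Eq.symm hω) hω'))
  · exact fun t => h.measurable m (measurableSet_singleton _)
  · intro s t hst
    exact Set.disjoint_left.2 fun ω hω hω' =>
      hst (Subtype.ext (Eq.trans (Eq.symm hω.1) hω'.1))
  · exact fun t => (h.measurable m (measurableSet_singleton _)).inter
      (h.measurable (m + 1) (measurableSet_singleton _))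

/-- Given the saturation time `t`, the out-degree of the bucket of `j` is a pure birth chain. -/
theorem measure_saturationTime_labelOutDegree [IsProbabilityMeasure P]
    (h : IsGrowthProcess p T P) (hp : ∀ t : BucketTree b, ∑ v ∈ t.nodes, p t v = 1)
    {q : ℕ → ℕ → ℝ}
    (hq : ∀ (t : BucketTree b) (v : ℕ), t.capacity v = b → p t v = q t.size (t.outDegree v))
    {n j : ℕ} (hj : 1 ≤ j) (hjn : j ≤ n) {t : ℕ} (hjt : j ≤ t) (N : ℕ) (hN : t + N ≤ n) (d : ℕ) :
    P {ω | saturationTime T n j ω = t ∧ labelOutDegree T (t + N) j ω = d} =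
      P {ω | saturationTime T n j ω = t} * pureBirthLaw q t N d := by
  have hpath := h.ae_isGrowthPath hp
  induction N generalizing d with
  | zero =>
    simp only [pureBirthLaw, PMF.pure_apply, add_zero]
    split_ifs with hd
    · rw [mul_one]
      refine measure_congr ?_
      filter_upwards [hpath] with ω hω
      refine propext ⟨fun hτ => hτ.1, fun hτ => ⟨hτ, ?_⟩⟩
      rw [← hτ, hd]
      exact labelOutDegree_saturationTime hω hj hjn
    · rw [mul_zero, ← nonpos_iff_eq_zero, ← measure_empty (μ := P)]
      refine measure_mono_ae ?_
      filter_upwards [hpath] with ω hω hτ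
      refine hd ?_
      rw [← hτ.2, ← hτ.1]
      exact labelOutDegree_saturationTime hω hj hjn
  | succ N ih =>
    set m := t + N with hm
    have htn : t < n := by omega
    -- The event "`τ = t` and out-degree `d` at time `m`", written as a property of `T m` alone; `E`
    -- is the event that the bucket of `j` attracts the next label.
    let A : ℕ → Set (BucketTree b) := fun d =>
      {s | s.size = m ∧ s.SaturatedExactlyAt j t ∧ s.outDegree (s.node j) = d}
    let E : Set Ω := {ω | ∃ hv : (T m ω).node j ∈ (T m ω).nodes,
      T (m + 1) ω = (T m ω).attract ((T m ω).node j) hv}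
    have hE : MeasurableSet E := h.measurableSet_attract m fun s => s.node j
    have hcap : ∀ s : BucketTree b, s.size = m → s.SaturatedExactlyAt j t →
        s.capacity (s.node j) = b := fun s hs hsat => by
      refine le_antisymm (s.card_le _) ?_
      rw [← s.partialCapacity_size j]
      exact hsat.1.ge.trans (s.partialCapacity_mono j (by omega))
    have hA : ∀ d, P {ω | T m ω ∈ A d} =
        P {ω | saturationTime T n j ω = t} * pureBirthLaw q t N d := fun d => by
      rw [← ih (by omega) d]
      refine measure_congr ?_
      filter_upwards [hpath] with ω hω
      refine propext ?_
      change _ ∧ _ ∧ _ ↔ _ ∧ _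
      rw [saturationTime_eq_iff hω hj hjt htn (m := m) (by omega)]
      exact and_iff_right (hω.size_eq (by omega))
    have hAm : ∀ d, MeasurableSet {ω | T m ω ∈ A d} := fun d =>
      h.measurable m MeasurableSet.of_discrete
    have hAE : ∀ d, P ({ω | T m ω ∈ A d} ∩ E) =
        P {ω | T m ω ∈ A d} * ENNReal.ofReal (q m d) := fun d =>
      h.measure_mem_and_attract (by omega) (A d) (fun s => s.node j)
        (fun s hs => s.node_mem_nodes (mem_Icc.2 (by have := hs.1; omega))) _
        (fun s hs => by rw [hq s _ (hcap s hs.1 hs.2.1), hs.1, hs.2.2])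
    have hAE' : ∀ d, P ({ω | T m ω ∈ A d} \ E) =
        P {ω | T m ω ∈ A d} * (1 - ENNReal.ofReal (q m d)) := fun d => by
      rw [ENNReal.mul_sub fun _ _ => measure_ne_top _ _, mul_one, ← hAE]
      exact ENNReal.eq_sub_of_add_eq (measure_ne_top _ _) (measure_sdiff_add_inter _ hE)
    -- The truncation at `1` is harmless: where `q m d ≥ 1`, the product formula already forces `E`
    -- to fill the whole event up to a null set.
    have hAE_min : ∀ d, P ({ω | T m ω ∈ A d} ∩ E) =
        P {ω | T m ω ∈ A d} * min 1 (ENNReal.ofReal (q m d)) := fun d => by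
      rcases le_total 1 (ENNReal.ofReal (q m d)) with h1 | h1
      · rw [min_eq_left h1, mul_one]
        refine le_antisymm (measure_mono Set.inter_subset_left) ?_
        rw [hAE]
        exact le_mul_of_one_le_right' h1
      · rw [min_eq_right h1, hAE]
    have hmove : ∀ᵐ ω ∂P, labelOutDegree T (m + 1) j ω =
        labelOutDegree T m j ω + (open Classical in if ω ∈ E then 1 else 0) ∨
        saturationTime T n j ω ≠ t := by
      filter_upwards [hpath] with ω hω
      rw [or_iff_not_imp_right, not_not]
      intro hτ
      rw [saturationTime_eq_iff hω hj hjt htn (m := m) (by omega)] at hτ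
      obtain ⟨v, hv, he⟩ := hω.step m (by omega)
      have hsz : (T m ω).size = m := hω.size_eq (by omega)
      have hEv : ω ∈ E ↔ v = (T m ω).node j := by
        constructor
        · rintro ⟨hv', he'⟩
          exact (T m ω).attract_injective hv hv' (he.symm.trans he')
        · rintro rfl
          exact ⟨hv, he⟩
      unfold labelOutDegree
      simp only [hEv]
      change T (m + 1) ω = _ at he
      rw [he, attract_node _ _ _ (by omega), outDegree_attract _ _ _ (hcap _ hsz hτ)]
    have hset : ∀ᵐ ω ∂P, ∀ d, T m ω ∈ A d ↔
        (saturationTime T n j ω = t ∧ labelOutDegree T m j ω = d) := by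
      filter_upwards [hpath] with ω hω d
      rw [saturationTime_eq_iff hω hj hjt htn (m := m) (by omega)]
      exact and_iff_right (hω.size_eq (by omega))
    rw [← add_assoc, ← hm]
    cases d with
    | zero =>
      rw [pureBirthLaw_succ_apply_zero, ← mul_assoc, ← hA, ← hm, ← hAE']
      refine measure_congr ?_
      filter_upwards [hset, hmove] with ω h1 h2
      refine propext ?_
      change _ ∧ _ ↔ T m ω ∈ A 0 ∧ ω ∉ E
      rw [h1]
      split_ifs at h2 with h3 <;> grind
    | succ d =>
      rw [pureBirthLaw_succ_apply_succ, mul_add, ← mul_assoc, ← mul_assoc, ← hA, ← hA, ← hm,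
        ← hAE', ← hAE_min, ← measure_union _ ((hAm d).inter hE)]
      · refine measure_congr ?_
        filter_upwards [hset, hmove] with ω h1 h2
        refine propext ?_
        change _ ∧ _ ↔ (T m ω ∈ A (d + 1) ∧ ω ∉ E) ∨ (T m ω ∈ A d ∧ ω ∈ E)
        rw [h1, h1]
        split_ifs at h2 with h3 <;> grind
      · exact Set.disjoint_left.2 fun ω hω hω' => hω.2 hω'.2

end IsGrowthProcess

/-! ### Mixing conditional laws over a discrete time. -/

section Mixture

variable {Ω Ω' E : Type*} [MeasurableSpace Ω] [MeasurableSpace Ω'] [MeasurableSpace E]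

theorem measure_eq_tsum_preimage_singleton_inter {P : Measure Ω} {τ : Ω → ℕ}
    (hτ : AEMeasurable τ P) {C : Set Ω} (hC : NullMeasurableSet C P) :
    P C = ∑' t, P (τ ⁻¹' {t} ∩ C) := by
  rw [← measure_iUnion₀]
  · congr 1
    ext ω
    simp
  · intro s t hst
    refine Disjoint.aedisjoint (Set.disjoint_left.2 fun ω hω hω' => hst ?_)
    exact Eq.trans (Eq.symm hω.1) hω'.1
  · exact fun t => (hτ.nullMeasurable (measurableSet_singleton t)).inter hC

/-- If, conditionally on `τ = t`, the law of `X` is the law `ν t` of a variable `Z t` independent of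
`τ'`, and `τ'` is distributed as `τ`, then `(τ, X)` is distributed as `(τ', Z τ')`. -/
theorem identDistrib_prodMk_of_conditional_law {P : Measure Ω} {P' : Measure Ω'}
    {τ : Ω → ℕ} {X : Ω → E} {τ' : Ω' → ℕ} {Z : ℕ → Ω' → E} (hτ : Measurable τ)
    (hX : Measurable X) (hττ : IdentDistrib τ' τ P' P) (S : Set ℕ) (hS : ∀ᵐ ω ∂P, τ ω ∈ S)
    (ν : ℕ → Measure E) (hZ : ∀ t ∈ S, HasLaw (Z t) (ν t) P' ∧ IndepFun τ' (Z t) P')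
    (hν : ∀ t ∈ S, ∀ B, MeasurableSet B →
      P (τ ⁻¹' {t} ∩ X ⁻¹' B) = P (τ ⁻¹' {t}) * ν t B) :
    IdentDistrib (fun ω => (τ ω, X ω)) (fun ω => (τ' ω, Z (τ' ω) ω)) P P' := by
  have hτ' := hττ.aemeasurable_fst
  have hlaw : ∀ t, P' (τ' ⁻¹' {t}) = P (τ ⁻¹' {t}) := fun t =>
    hττ.measure_mem_eq (measurableSet_singleton t)
  have hnull : ∀ t ∉ S, P (τ ⁻¹' {t}) = 0 := fun t ht => by
    refine measure_mono_null ?_ (ae_iff.1 hS)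
    rintro ω rfl
    exact ht
  -- Glued from the pieces `τ' = t`; pieces with `t ∉ S` are null, so nothing is required of `Z t`
  -- there.
  have hZm : AEMeasurable (fun ω => Z (τ' ω) ω) P' := by
    have hcover : ⋃ t, τ' ⁻¹' {t} = Set.univ := by ext ω; simp
    rw [← Measure.restrict_univ (μ := P'), ← hcover, aemeasurable_iUnion_iff]
    intro t
    by_cases ht : t ∈ S
    · refine (hZ t ht).1.aemeasurable.restrict.congr ?_
      filter_upwards [ae_restrict_mem₀ (hτ'.nullMeasurable (measurableSet_singleton t))] with ω hω
      rw [show τ' ω = t from hω]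
    · rw [Measure.restrict_eq_zero.2 ((hlaw t).trans (hnull t ht))]
      exact aemeasurable_zero_measure
  have hpair : AEMeasurable (fun ω => (τ' ω, Z (τ' ω) ω)) P' := hτ'.prodMk hZm
  refine ⟨(hτ.prodMk hX).aemeasurable, hpair, Measure.ext fun A hA => ?_⟩
  rw [Measure.map_apply (hτ.prodMk hX) hA, Measure.map_apply_of_aemeasurable hpair hA,
    measure_eq_tsum_preimage_singleton_inter hτ.aemeasurable
      ((hτ.prodMk hX) hA).nullMeasurableSet,
    measure_eq_tsum_preimage_singleton_inter hτ' (hpair.nullMeasurable hA)]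
  refine tsum_congr fun t => ?_
  have hB : MeasurableSet (Prod.mk t ⁻¹' A) := measurable_prodMk_left hA
  by_cases ht : t ∈ S
  · have h1 : τ ⁻¹' {t} ∩ (fun ω => (τ ω, X ω)) ⁻¹' A = τ ⁻¹' {t} ∩ X ⁻¹' (Prod.mk t ⁻¹' A) := by
      ext ω
      refine and_congr_right fun h => ?_
      simp [show τ ω = t from h]
    have h2 : τ' ⁻¹' {t} ∩ (fun ω => (τ' ω, Z (τ' ω) ω)) ⁻¹' A =
        τ' ⁻¹' {t} ∩ Z t ⁻¹' (Prod.mk t ⁻¹' A) := by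
      ext ω
      refine and_congr_right fun h => ?_
      simp [show τ' ω = t from h]
    rw [h1, h2, hν t ht _ hB, (hZ t ht).2.measure_inter_preimage_eq_mul _ _
      (measurableSet_singleton t) hB, hlaw, ← (hZ t ht).1.map_eq,
      Measure.map_apply_of_aemeasurable (hZ t ht).1.aemeasurable hB]
  · rw [measure_mono_null Set.inter_subset_left (hnull t ht),
      measure_mono_null Set.inter_subset_left ((hlaw t).trans (hnull t ht))]

end Mixture

/-! ### Indicator sums and urns as pure birth chains. -/

/-- The law of a sum of independent indicators as a law of a pure birth chain. -/
theorem hasLaw_sum_indicators {Ω : Type*} [MeasurableSpace Ω] {P : Measure Ω}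
    [IsProbabilityMeasure P] {q : ℕ → ℝ} {I : ℕ → Ω → ℕ} {b n : ℕ}
    (hq : ∀ m ∈ Ico b n, q m ∈ Set.Icc (0 : ℝ) 1)
    (hI : ∀ m ∈ Ico b n, Measurable (I (m + 1)) ∧
      P {ω | I (m + 1) ω = 1} = ENNReal.ofReal (q m) ∧
      P {ω | I (m + 1) ω = 0} = ENNReal.ofReal (1 - q m))
    (hind : iIndepFun (fun ℓ : Ioc b n => I ℓ) P) {t : ℕ} (hbt : b ≤ t) (N : ℕ)
    (hN : t + N ≤ n) :
    HasLaw (fun ω => ∑ ℓ ∈ Ioc t (t + N), I ℓ ω) (pureBirthLaw (fun m _ => q m) t N).toMeasure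
      P := by
  have hmeas : ∀ ℓ ∈ Ioc b n, Measurable (I ℓ) := fun ℓ hℓ => by
    rw [mem_Ioc] at hℓ
    have := (hI (ℓ - 1) (mem_Ico.2 (by omega))).1
    rwa [Nat.sub_add_cancel (by omega)] at this
  have hsum : ∀ M, t + M ≤ n → Measurable fun ω => ∑ ℓ ∈ Ioc t (t + M), I ℓ ω := fun M hM =>
    Finset.measurable_sum _ fun ℓ hℓ => hmeas ℓ (by rw [mem_Ioc] at *; omega)
  refine ⟨(hsum N hN).aemeasurable, Measure.ext_of_singleton fun d => ?_⟩
  rw [Measure.map_apply (hsum N hN) (measurableSet_singleton d),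
    PMF.toMeasure_apply_singleton _ _ (measurableSet_singleton d)]
  induction N generalizing d with
  | zero =>
    by_cases hd : d = 0
    · subst hd; simp [pureBirthLaw]
    · simp [pureBirthLaw, hd, Ne.symm hd]
  | succ N ih =>
    have hm : t + N ∈ Ico b n := mem_Ico.2 (by omega)
    -- The indicator with index `m + 1` drives the step from time `m` to `m + 1`, hence the
    -- denominator `ℓ - 1` in the theorem.
    obtain ⟨hJm, hJ1, hJ0⟩ := hI _ hm
    obtain ⟨hq0, hq1⟩ := hq _ hm
    set J := I (t + N + 1) with hJ
    set R : Ω → ℕ := fun ω => ∑ ℓ ∈ Ioc t (t + N), I ℓ ω with hR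
    have hRm : Measurable R := hsum N (by omega)
    have hRJ : ∀ ω, ∑ ℓ ∈ Ioc t (t + (N + 1)), I ℓ ω = R ω + J ω := fun ω => by
      rw [← add_assoc, Finset.sum_Ioc_succ_top (by omega)]
    have hindep : IndepFun R J P := by
      let s : Finset (Ioc b n) := univ.filter fun ℓ => t < ℓ.1 ∧ ℓ.1 ≤ t + N
      have hmem : t + N + 1 ∈ Ioc b n := mem_Ioc.2 (by omega)
      have := hind.indepFun_finsetSum_of_notMem (fun ℓ => hmeas ℓ.1 ℓ.2) (s := s)
        (i := ⟨t + N + 1, hmem⟩) (by simp [s])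
      convert this using 1
      funext ω
      rw [Finset.sum_apply, sum_filter, sum_coe_sort (Ioc b n) fun ℓ =>
        if t < ℓ ∧ ℓ ≤ t + N then I ℓ ω else 0, ← sum_filter]
      refine sum_congr ?_ fun _ _ => rfl
      ext ℓ
      simp only [mem_filter, mem_Ioc]
      omega
    -- The probabilities of the values `0` and `1` add up to one.
    have hJae : ∀ᵐ ω ∂P, J ω = 0 ∨ J ω = 1 := by
      have hm0 : MeasurableSet {ω | J ω = 0} := hJm (measurableSet_singleton 0)
      have hm1 : MeasurableSet {ω | J ω = 1} := hJm (measurableSet_singleton 1)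
      refine (mem_ae_iff_prob_eq_one (hm0.union hm1)).2 ?_
      rw [measure_union _ hm1, hJ0, hJ1, ← ENNReal.ofReal_add (sub_nonneg.2 hq1) hq0,
        sub_add_cancel, ENNReal.ofReal_one]
      refine Set.disjoint_left.2 fun ω hω hω' => ?_
      have h1 : J ω = 0 := hω
      have h2 : J ω = 1 := hω'
      omega
    have hmul : ∀ k i, P {ω | R ω = k ∧ J ω = i} = pureBirthLaw (fun m _ => q m) t N k *
        P {ω | J ω = i} := fun k i => by
      rw [← ih (by omega) k]
      exact hindep.measure_inter_preimage_eq_mul _ _ (measurableSet_singleton k)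
        (measurableSet_singleton i)
    have hJ0' : P {ω | J ω = 0} = 1 - ENNReal.ofReal (q (t + N)) := by
      rw [hJ0, ENNReal.ofReal_sub _ hq0, ENNReal.ofReal_one]
    have hJ1' : P {ω | J ω = 1} = min 1 (ENNReal.ofReal (q (t + N))) := by
      rw [hJ1, min_eq_right (ENNReal.ofReal_le_one.2 hq1)]
    have hm2 : ∀ k i, MeasurableSet {ω | R ω = k ∧ J ω = i} := fun k i =>
      (hRm (measurableSet_singleton k)).inter (hJm (measurableSet_singleton i))
    cases d with
    | zero =>
      rw [pureBirthLaw_succ_apply_zero, ← hJ0', ← hmul]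
      refine measure_congr (.of_forall fun ω => propext ?_)
      change ∑ ℓ ∈ Ioc t (t + (N + 1)), I ℓ ω = 0 ↔ R ω = 0 ∧ J ω = 0
      rw [hRJ]
      omega
    | succ d =>
      rw [pureBirthLaw_succ_apply_succ, ← hJ0', ← hJ1', ← hmul, ← hmul, ← measure_union _ (hm2 _ _)]
      · refine measure_congr ?_
        filter_upwards [hJae] with ω hω
        refine propext ?_
        change ∑ ℓ ∈ Ioc t (t + (N + 1)), I ℓ ω = d + 1 ↔
          (R ω = d + 1 ∧ J ω = 0) ∨ (R ω = d ∧ J ω = 1)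
        rw [hRJ]
        omega
      · refine Set.disjoint_left.2 fun ω hω hω' => ?_
        have h1 : J ω = 0 := hω.2
        have h2 : J ω = 1 := hω'.2
        omega

theorem drawBall_congr {s s' : ℝ × ℝ} (h : s.1 / (s.1 + s.2) = s'.1 / (s'.1 + s'.2)) :
    drawBall s = drawBall s' := by
  ext c
  cases c
  · rw [drawBall_false, drawBall_false, h]
  · rw [drawBall_true, drawBall_true, h]

/-- Balance makes the total after `N` draws deterministic, so the number `d` of white draws
determines the whole composition: each draw adds `1 + α` balls, and a white one turns one of these
white. -/
theorem triangularUrn_eq_map_pureBirthLaw {α w₀ b₀ : ℝ} {q : ℕ → ℕ → ℝ} {t : ℕ}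
    (hq : ∀ N d : ℕ, q (t + N) d = (w₀ + d) / (w₀ + b₀ + (1 + α) * N)) (N : ℕ) :
    triangularUrn α w₀ b₀ N =
      (pureBirthLaw q t N).map fun d : ℕ => (w₀ + (d : ℝ), b₀ + (1 + α) * N - (d : ℝ)) := by
  induction N with
  | zero => simp [triangularUrn, pureBirthLaw, PMF.pure_map]
  | succ N ih =>
    rw [triangularUrn, pureBirthLaw, ih, PMF.bind_map, PMF.map_bind]
    congr 1
    funext d
    have h : drawBall (w₀ + (d : ℝ), b₀ + (1 + α) * N - (d : ℝ)) =
        drawBall (q (t + N) d, 1 - q (t + N) d) := by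
      refine drawBall_congr ?_
      simp only
      rw [add_sub_cancel, div_one, hq]
      congr 1
      ring
    simp only [Function.comp]
    rw [h, PMF.map_comp]
    congr 1
    funext c
    cases c <;> refine Prod.ext ?_ ?_ <;> simp <;> ring

theorem whiteBallLaw_eq_map_pureBirthLaw {α w₀ b₀ : ℝ} {q : ℕ → ℕ → ℝ} {t : ℕ}
    (hq : ∀ N d : ℕ, q (t + N) d = (w₀ + d) / (w₀ + b₀ + (1 + α) * N)) (N : ℕ) :
    whiteBallLaw α w₀ b₀ N = (pureBirthLaw q t N).toMeasure.map fun d : ℕ => w₀ + (d : ℝ) := by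
  rw [whiteBallLaw, triangularUrn_eq_map_pureBirthLaw hq, PMF.map_comp,
    ← PMF.toMeasure_map _ _ Measurable.of_discrete]
  rfl

/-! ### The joint law and the two tree models. -/

/-- The joint law of the saturation time and the out-degree of the bucket of `j` in a growth process
whose rule depends, at a saturated node, only on the size of the tree and the out-degree. -/
theorem IsGrowthProcess.identDistrib_saturationTime_labelOutDegree {b : ℕ} {Ω Ω' E : Type*}
    [MeasurableSpace Ω] [MeasurableSpace Ω'] [MeasurableSpace E] {P : Measure Ω}
    [IsProbabilityMeasure P] {P' : Measure Ω'} {p : BucketTree b → ℕ → ℝ}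
    {T : ℕ → Ω → BucketTree b} (h : IsGrowthProcess p T P)
    (hp : ∀ t : BucketTree b, ∑ v ∈ t.nodes, p t v = 1) {q : ℕ → ℕ → ℝ}
    (hq : ∀ (t : BucketTree b) (v : ℕ), t.capacity v = b → p t v = q t.size (t.outDegree v))
    {n j : ℕ} (hj : 1 ≤ j) (hjn : j ≤ n) {τ' : Ω' → ℕ}
    (hτ : IdentDistrib τ' (saturationTime T n j) P' P) (f : ℕ → E) (Z : ℕ → Ω' → E)
    (hZ : ∀ t ∈ Icc (min b n) n,
      HasLaw (Z t) ((pureBirthLaw q t (n - t)).toMeasure.map f) P' ∧ IndepFun τ' (Z t) P') :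
    IdentDistrib (fun ω => (saturationTime T n j ω, f (labelOutDegree T n j ω)))
      (fun ω => (τ' ω, Z (τ' ω) ω)) P P' := by
  have hf : Measurable f := .of_discrete
  have hX := measurable_labelOutDegree h.measurable n j
  have hτm := measurable_saturationTime h.measurable n j
  refine identDistrib_prodMk_of_conditional_law hτm (hf.comp hX) hτ
    {t | t ∈ Icc j n ∧ t ∈ Icc (min b n) n} ?_
    (fun t => (pureBirthLaw q t (n - t)).toMeasure.map f) (fun t ht => hZ t ht.2) ?_
  · filter_upwards [h.ae_isGrowthPath hp] with ω hω
    have h1 := (saturationTime_spec hω hj hjn).1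
    exact ⟨h1, mem_Icc.2 ⟨min_le_saturationTime hω hj hjn, (mem_Icc.1 h1).2⟩⟩
  · rintro t ⟨ht, -⟩ B hB
    rw [mem_Icc] at ht
    change P (_ ∩ labelOutDegree T n j ⁻¹' (f ⁻¹' B)) = _
    rw [Measure.map_apply hf hB, Set.inter_comm,
      ← Measure.restrict_apply (hX (hf hB)), ← Measure.map_apply hX (hf hB)]
    have : (P.restrict (saturationTime T n j ⁻¹' {t})).map (labelOutDegree T n j) =
        P (saturationTime T n j ⁻¹' {t}) • (pureBirthLaw q t (n - t)).toMeasure := by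
      refine Measure.ext_of_singleton fun d => ?_
      rw [Measure.map_apply hX (measurableSet_singleton d),
        Measure.restrict_apply (hX (measurableSet_singleton d)), Set.inter_comm,
        Measure.smul_apply, PMF.toMeasure_apply_singleton _ _ (measurableSet_singleton d)]
      have := h.measure_saturationTime_labelOutDegree hp hq hj hjn ht.1 (n - t) (by omega) d
      rw [Nat.add_sub_cancel' ht.2] at this
      exact this
    rw [this, Measure.smul_apply, smul_eq_mul]

theorem mainTheorem4 (b : ℕ) (hb : 1 ≤ b) (n j : ℕ) (hj : 1 ≤ j) (hjn : j ≤ n)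
    {Ω : Type*} [MeasurableSpace Ω] (P : Measure Ω) [IsProbabilityMeasure P]
    (T : ℕ → Ω → BucketTree b)
    {Ω' : Type*} [MeasurableSpace Ω'] (P' : Measure Ω') [IsProbabilityMeasure P'] :
    -- bucket recursive trees
    (IsGrowthProcess BucketTree.recursiveRule T P →
      ∀ (τ' : Ω' → ℕ) (I : ℕ → Ω' → ℕ),
        IdentDistrib τ' (saturationTime T n j) P' P →
        (∀ ℓ ∈ Finset.Ioc b n, Measurable (I ℓ) ∧
          P' {ω | I ℓ ω = 1} = ENNReal.ofReal ((b : ℝ) / ((ℓ : ℝ) - 1)) ∧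
          P' {ω | I ℓ ω = 0} = ENNReal.ofReal (1 - (b : ℝ) / ((ℓ : ℝ) - 1))) →
        iIndepFun (fun (ℓ : Finset.Ioc b n) => I ℓ) P' →
        IndepFun τ' (fun ω (ℓ : Finset.Ioc b n) => I ℓ ω) P' →
        IdentDistrib (labelOutDegree T n j)
          (fun ω => ∑ ℓ ∈ Finset.Ioc (τ' ω) n, I ℓ ω) P P' ∧
        IdentDistrib (fun ω => (saturationTime T n j ω, labelOutDegree T n j ω))
          (fun ω => (τ' ω, ∑ ℓ ∈ Finset.Ioc (τ' ω) n, I ℓ ω)) P P') ∧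
    -- (b, α)-plane oriented recursive trees
    (∀ α : ℝ, 0 < α → IsGrowthProcess (BucketTree.portRule α) T P →
      ∀ (τ' : Ω' → ℕ) (W : ℕ → Ω' → ℝ),
        IdentDistrib τ' (saturationTime T n j) P' P →
        (∀ t ∈ Finset.Icc (min b n) n,
          HasLaw (W t) (whiteBallLaw α ((b : ℝ) * (α + 1) - 1) ((α + 1) * ((t : ℝ) - (b : ℝ)))
            (n - t)) P' ∧
          IndepFun τ' (W t) P') →
        IdentDistrib (fun ω => (labelOutDegree T n j ω : ℝ))
          (fun ω => W (τ' ω) ω - ((b : ℝ) * (α + 1) - 1)) P P' ∧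
        IdentDistrib (fun ω => (saturationTime T n j ω, (labelOutDegree T n j ω : ℝ)))
          (fun ω => (τ' ω, W (τ' ω) ω - ((b : ℝ) * (α + 1) - 1))) P P') := by
  refine ⟨fun h τ' I hτ hI hind hindτ => ?_, fun α hα h τ' W hτ hW => ?_⟩
  · have hmain := h.identDistrib_saturationTime_labelOutDegree
      BucketTree.sum_recursiveRule (q := fun m _ => (b : ℝ) / m)
      (fun t v hv => by rw [BucketTree.recursiveRule, hv]) hj hjn hτ id
      (fun t ω => ∑ ℓ ∈ Ioc t n, I ℓ ω) ?_
    · exact ⟨hmain.comp measurable_snd, hmain⟩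
    · intro t ht
      rw [mem_Icc] at ht
      have hIoc : Ioc t n = (Ioc b n).filter (t < ·) := by
        ext ℓ
        simp only [mem_filter, mem_Ioc]
        omega
      refine ⟨?_, ?_⟩
      · rw [Measure.map_id]
        -- The case `t = n` is separate because `t` may then be smaller than `b`; the sum is empty.
        rcases ht.2.eq_or_lt with rfl | htn
        · simp only [Ioc_self, sum_empty, Nat.sub_self, pureBirthLaw, PMF.toMeasure_pure]
          exact ⟨aemeasurable_const, by simp⟩
        · have := hasLaw_sum_indicators (P := P') (q := fun m => (b : ℝ) / m) (I := I) (b := b)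
            (n := n) ?_ ?_ hind (t := t) (by omega) (n - t) (by omega)
          · rwa [Nat.add_sub_cancel' ht.2] at this
          · intro m hm
            have hbm : (b : ℝ) ≤ m := by exact_mod_cast (mem_Ico.1 hm).1
            exact ⟨by positivity, div_le_one_of_le₀ hbm (by positivity)⟩
          · intro m hm
            rw [mem_Ico] at hm
            have := hI (m + 1) (mem_Ioc.2 (by omega))
            simpa using this
      · have hsum : (fun ω => ∑ ℓ ∈ Ioc t n, I ℓ ω) = (fun x : Ioc b n → ℕ =>
            ∑ ℓ, if t < ℓ.1 then x ℓ else 0) ∘ fun ω ℓ => I ℓ ω := by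
          funext ω
          simp only [Function.comp]
          rw [sum_coe_sort (Ioc b n) fun ℓ => if t < ℓ then I ℓ ω else 0, ← sum_filter, hIoc]
        rw [hsum]
        exact hindτ.comp measurable_id Measurable.of_discrete
  · have hmain := h.identDistrib_saturationTime_labelOutDegree
      (BucketTree.sum_portRule hα)
      (q := fun m d => ((d : ℝ) + (α + 1) * b - 1) / ((α + 1) * m - 1))
      (fun t v hv => by rw [BucketTree.portRule, hv]) hj hjn hτ (Nat.cast (R := ℝ))
      (fun t ω => W t ω - ((b : ℝ) * (α + 1) - 1)) ?_
    · exact ⟨hmain.comp measurable_snd, hmain⟩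
    · intro t ht
      obtain ⟨h1, h2⟩ := hW t ht
      have hsub : Measurable fun x : ℝ => x - ((b : ℝ) * (α + 1) - 1) := by fun_prop
      refine ⟨⟨hsub.comp_aemeasurable h1.aemeasurable, ?_⟩, h2.comp measurable_id hsub⟩
      have hlaw := h1.map_eq
      rw [whiteBallLaw_eq_map_pureBirthLaw (t := t)
        (q := fun m d => ((d : ℝ) + (α + 1) * b - 1) / ((α + 1) * m - 1))] at hlaw
      · change P'.map ((fun x : ℝ => x - ((b : ℝ) * (α + 1) - 1)) ∘ W t) = _
        rw [← AEMeasurable.map_map_of_aemeasurable hsub.aemeasurable h1.aemeasurable, hlaw,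
          Measure.map_map hsub Measurable.of_discrete]
        congr 1
        funext d
        simp
      -- The initial total is `w₀ + b₀ = (α + 1) t - 1`, the PORT denominator at time `t`, and `w₀ +
      -- d` is the PORT numerator of a full bucket.
      · intro N d
        push_cast
        congr 1 <;> ring
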